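/- Call a subset of a topological space $X$ a zero set if it is of the form $g^{-1}(0)$ for a continuous $g:X\to\mathbb R$, and functionally $F_\sigma$ if it is the union of a sequence of zero sets. Call $X$ strongly zero-dimensional if, whenever $A,B\subseteq X$ are completely separated (i.e. some continuous $g:X\to[0,1]$ is $0$ on $A$ and $1$ on $B$), there is a clopen set $U$ with $A\subseteq U\subseteq X\setminus B$. For topological spaces $X,Y$ let ${\rm K}_1(X,Y)$ be the set of all maps $f:X\to Y$ such that $f^{-1}(V)$ is functionally $F_\sigma$ in $X$ for every open $V\subseteq Y$, and let ${\rm B}_1(X,Y)$ be the set of all pointwise limits of sequences of continuous maps $X\to Y$. Theorem. Let $X$ be a completely metrizable strongly zero-dimensional space and let $Y$ be a metrizable space. Then $${\rm K}_1(X,Y)={\rm B}_1(X,Y).$$ In particular, every map $f:X\to Y$ such that $f^{-1}(V)$ is an $F_\sigma$-set in $X$ for every open $V\subseteq Y$ is a pointwise limit of a sequence of continuous maps $X\to Y$. -/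

import Mathlib

open Filter Topology

namespace BaireOne

/-- A zero set: the set of zeros of a continuous real-valued function. -/
def IsZeroSet {X : Type*} [TopologicalSpace X] (A : Set X) : Prop :=
  ∃ g : X → ℝ, Continuous g ∧ A = {x | g x = 0}

/-- A functionally `F_σ`-set: the union of a sequence of zero sets. -/
def IsFunctionallyFσ {X : Type*} [TopologicalSpace X] (A : Set X) : Prop :=
  ∃ Z : ℕ → Set X, (∀ n, IsZeroSet (Z n)) ∧ A = ⋃ n, Z n

/-- An `F_σ`-set: the union of a sequence of closed sets. -/
def IsFσ {X : Type*} [TopologicalSpace X] (A : Set X) : Prop :=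
  ∃ F : ℕ → Set X, (∀ n, IsClosed (F n)) ∧ A = ⋃ n, F n

/-- `A` and `B` are completely separated: some continuous function `X → [0,1]` is `0` on `A`
and `1` on `B`. -/
def CompletelySeparated {X : Type*} [TopologicalSpace X] (A B : Set X) : Prop :=
  ∃ g : X → ℝ, Continuous g ∧ (∀ x, g x ∈ Set.Icc (0 : ℝ) 1) ∧
    (∀ x ∈ A, g x = 0) ∧ (∀ x ∈ B, g x = 1)

/-- Strong zero-dimensionality: completely separated sets are separated by a clopen set. -/
def StronglyZeroDimensional (X : Type*) [TopologicalSpace X] : Prop :=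
  ∀ A B : Set X, CompletelySeparated A B → ∃ U : Set X, IsClopen U ∧ A ⊆ U ∧ U ⊆ Bᶜ

/-- The first Baire class `B₁(X,Y)`: pointwise limits of sequences of continuous maps. -/
def B₁ (X Y : Type*) [TopologicalSpace X] [TopologicalSpace Y] : Set (X → Y) :=
  {f | ∃ u : ℕ → X → Y, (∀ n, Continuous (u n)) ∧
    ∀ x, Tendsto (fun n => u n x) atTop (𝓝 (f x))}

/-- The first Lebesgue class `H₁(X,Y)`: preimages of open sets are `F_σ`. -/
def H₁ (X Y : Type*) [TopologicalSpace X] [TopologicalSpace Y] : Set (X → Y) :=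
  {f | ∀ V : Set Y, IsOpen V → IsFσ (f ⁻¹' V)}

/-- The first functional Lebesgue class `K₁(X,Y)`: preimages of open sets are
functionally `F_σ`. -/
def K₁ (X Y : Type*) [TopologicalSpace X] [TopologicalSpace Y] : Set (X → Y) :=
  {f | ∀ V : Set Y, IsOpen V → IsFunctionallyFσ (f ⁻¹' V)}

end BaireOne

/-! The substance is `H₁_subset_B₁`. By Baire category, `f` in `H₁` has small oscillation on some
nonempty relatively open part of each nonempty closed set (`H₁.exists_isOpen_dist_le`). Peeling such
parts off transfinitely gives, for each `n`, an upper semicontinuous ordinal rank `r n` on whose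
levels `f` varies by at most `1/(n+1)`.

Strong zero-dimensionality gives clopen partitions of mesh tending to 0. The `k`-th approximation is
constant on each cell, with value `f z`, where `z` maximises as many of the ranks `r 0, r 1, ...`
(up to `r k`) as can be maximised together. Near `x` no rank `r i` with `i ≤ n` exceeds its value at
`x`, so in a small cell `z` and `x` share the rank `r n`, and `f z` is close to `f x`. -/

namespace BaireOne

open Set

universe u

/-! ### Points of small oscillation, by Baire category -/

section Oscillation

/-- A sequence in which every term is computed from the preceding ones. -/
def historyRec {Z : Type*} (step : (m : ℕ) → (Fin m → Z) → Z) (m : ℕ) : Z :=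
  step m fun i => historyRec step i
termination_by m
decreasing_by exact i.2

theorem H₁.comp_continuous {X Y Z : Type*} [TopologicalSpace X] [TopologicalSpace Y]
    [TopologicalSpace Z] {f : X → Y} (hf : f ∈ H₁ X Y) {i : Z → X} (hi : Continuous i) :
    f ∘ i ∈ H₁ Z Y := by
  intro V hV
  obtain ⟨F, hF, hFV⟩ := hf V hV
  refine ⟨fun n => i ⁻¹' F n, fun n => (hF n).preimage hi, ?_⟩
  rw [preimage_comp, hFV, preimage_iUnion]

theorem H₁.isGδ_preimage {X Y : Type*} [TopologicalSpace X] [TopologicalSpace Y]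
    {f : X → Y} (hf : f ∈ H₁ X Y) {C : Set Y} (hC : IsClosed C) : IsGδ (f ⁻¹' C) := by
  obtain ⟨F, hF, hFV⟩ := hf Cᶜ hC.isOpen_compl
  have : f ⁻¹' C = ⋂ n, (F n)ᶜ := by
    rw [← compl_iUnion, ← hFV, preimage_compl, compl_compl]
  rw [this]
  exact .iInter_of_isOpen fun n => (hF n).isOpen_compl

theorem H₁.exists_isOpen_subset_preimage {Z Y ι : Type*} [TopologicalSpace Z] [BaireSpace Z]
    [TopologicalSpace Y] {f : Z → Y} (hf : f ∈ H₁ Z Y) [Countable ι] {V : ι → Set Y}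
    (hV : ∀ i, IsOpen (V i)) {U : Set Z} (hU : IsOpen U) (hne : U.Nonempty)
    (hcov : ∀ x ∈ U, ∃ i, f x ∈ V i) :
    ∃ i, ∃ W : Set Z, IsOpen W ∧ W.Nonempty ∧ W ⊆ f ⁻¹' V i := by
  choose F hF hFV using fun i => hf (V i) (hV i)
  -- The extra closed set `Uᶜ` makes this a countable cover of all of `Z`.
  let K : Option (ι × ℕ) → Set Z := fun o => o.elim Uᶜ fun p => F p.1 p.2
  have hK : ∀ o, IsClosed (K o) := by
    rintro (_ | p)
    · exact hU.isClosed_compl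
    · exact hF _ _
  have hKU : ⋃ o, K o = univ := by
    refine eq_univ_of_forall fun x => mem_iUnion.2 ?_
    by_cases hx : x ∈ U
    · obtain ⟨i, hi⟩ := hcov x hx
      have : x ∈ ⋃ n, F i n := hFV i ▸ hi
      obtain ⟨n, hn⟩ := mem_iUnion.1 this
      exact ⟨some (i, n), hn⟩
    · exact ⟨none, hx⟩
  obtain ⟨x, hxU, hx⟩ :=
    (dense_iUnion_interior_of_closed hK hKU).inter_open_nonempty U hU hne
  obtain ⟨o, ho⟩ := mem_iUnion.1 hx
  rcases o with _ | ⟨i, n⟩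
  · exact absurd hxU (interior_subset ho)
  · refine ⟨i, interior (F i n), isOpen_interior, ⟨x, ho⟩, interior_subset.trans ?_⟩
    rw [hFV i]
    exact subset_iUnion (F i) n

/-- If no nonempty open set has a small image, there are two subsets with a common closure
whose images are far apart. -/
theorem exists_seq_dense_separated {Z Y : Type*} [MetricSpace Z] [MetricSpace Y] [Nonempty Z]
    {f : Z → Y} {δ : ℝ}
    (h : ∀ (s : Set Z), s.Finite → ∀ (x : Z) (η : ℝ), 0 < η →
      ∃ z, dist z x < η ∧ ∀ y ∈ s, δ ≤ dist (f z) (f y)) :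
    ∃ D : Bool → Set Z, (∀ b, (D b).Nonempty) ∧
      (∀ b, ∀ x ∈ D b, ∀ c, x ∈ closure (D c)) ∧
      ∀ x ∈ D true, ∀ y ∈ D false, δ ≤ dist (f x) (f y) := by
  choose! g hg hgs using h
  let x₀ : Z := Classical.arbitrary Z
  let step : (m : ℕ) → (Fin m → Z) → Z := fun m =>
    match m with
    | 0 => fun _ => x₀
    | m + 1 => fun p => g (range p)
        (p ⟨(Nat.unpair m).1, Nat.lt_succ_of_le (Nat.unpair_left_le m)⟩) (1 / ((m : ℝ) + 1))
  let x : ℕ → Z := historyRec step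
  have hx : ∀ m, x (m + 1) = g (range fun i : Fin (m + 1) => x i) (x (Nat.unpair m).1)
      (1 / ((m : ℝ) + 1)) := by
    intro m
    change historyRec step (m + 1) = _
    rw [historyRec]
  have hpos : ∀ m : ℕ, 0 < 1 / ((m : ℝ) + 1) := fun m => Nat.one_div_pos_of_nat
  have hclose : ∀ m, dist (x (m + 1)) (x (Nat.unpair m).1) < 1 / ((m : ℝ) + 1) := by
    intro m
    rw [hx]
    exact hg _ (finite_range _) _ _ (hpos m)
  have hsep : ∀ m n, m < n → δ ≤ dist (f (x n)) (f (x m)) := by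
    intro m n hmn
    obtain ⟨k, rfl⟩ : ∃ k, n = k + 1 := ⟨n - 1, by omega⟩
    rw [hx]
    exact hgs _ (finite_range _) _ _ (hpos k) _ ⟨⟨m, hmn⟩, rfl⟩
  -- Each term is approximated at arbitrarily late stages; the parity of the stage decides the
  -- class, so both classes accumulate at every term.
  let D : Bool → Set Z := fun b => {z | ∃ n k, z = x (Nat.pair n (2 * k + b.toNat) + 1)}
  refine ⟨D, fun b => ⟨_, 0, 0, rfl⟩, ?_, ?_⟩
  · rintro b _ ⟨n, k, rfl⟩ c
    generalize Nat.pair n (2 * k + b.toNat) + 1 = q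
    refine Metric.mem_closure_iff.2 fun η hη => ?_
    obtain ⟨j, hj⟩ := exists_nat_one_div_lt hη
    refine ⟨_, ⟨q, j, rfl⟩, ?_⟩
    have h1 := hclose (Nat.pair q (2 * j + c.toNat))
    rw [Nat.unpair_pair] at h1
    rw [dist_comm]
    refine h1.trans (lt_of_le_of_lt ?_ hj)
    apply Nat.one_div_le_one_div
    have := Nat.right_le_pair q (2 * j + c.toNat)
    omega
  · rintro _ ⟨n, k, rfl⟩ _ ⟨n', k', rfl⟩
    have hne : Nat.pair n (2 * k + true.toNat) ≠ Nat.pair n' (2 * k' + false.toNat) := by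
      intro h
      have := (Nat.pair_eq_pair.1 h).2
      simp only [Bool.toNat_true, Bool.toNat_false] at this
      omega
    rcases lt_or_gt_of_ne hne with h | h
    · rw [dist_comm]
      exact hsep _ _ (Nat.succ_lt_succ h)
    · exact hsep _ _ (Nat.succ_lt_succ h)

/-- Otherwise no ball has its image covered by finitely many `ε / 2`-balls, which yields two sets
with a common closure and images `ε / 2` apart. Preimages of closed thickenings of these images
would be disjoint dense `Gδ` sets in that closure. No separability of `Y` is needed. -/
theorem H₁.exists_isOpen_dist_le {Z Y : Type*} [MetricSpace Z] [CompleteSpace Z] [Nonempty Z]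
    [MetricSpace Y] {f : Z → Y} (hf : f ∈ H₁ Z Y) {ε : ℝ} (hε : 0 < ε) :
    ∃ U : Set Z, IsOpen U ∧ U.Nonempty ∧ ∀ x ∈ U, ∀ y ∈ U, dist (f x) (f y) ≤ ε := by
  by_contra! hcon
  have key : ∀ (s : Set Z), s.Finite → ∀ (x : Z) (η : ℝ), 0 < η →
      ∃ z, dist z x < η ∧ ∀ y ∈ s, ε / 2 ≤ dist (f z) (f y) := by
    intro s hs x η hη
    by_contra! hno
    have := hs.countable.to_subtype
    obtain ⟨y, W, hW, hWne, hWV⟩ := H₁.exists_isOpen_subset_preimage hf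
      (V := fun y : s => Metric.ball (f y) (ε / 2)) (fun _ => Metric.isOpen_ball)
      (U := Metric.ball x η) Metric.isOpen_ball ⟨x, Metric.mem_ball_self hη⟩
      (fun z hz => by
        obtain ⟨y, hy, hlt⟩ := hno z hz
        exact ⟨⟨y, hy⟩, hlt⟩)
    obtain ⟨a, ha, b, hb, hab⟩ := hcon W hW hWne
    have h1 : dist (f a) (f y) < ε / 2 := hWV ha
    have h2 : dist (f b) (f y) < ε / 2 := hWV hb
    have := dist_triangle_right (f a) (f b) (f y)
    linarith
  obtain ⟨D, hne, hcl, hsep⟩ := exists_seq_dense_separated key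
  let C : Set Z := closure (D true)
  have hDC : ∀ b, D b ⊆ C := fun b x hx => hcl b x hx true
  have hCD : ∀ b, C ⊆ closure (D b) := fun b =>
    closure_minimal (fun x hx => hcl true x hx b) isClosed_closure
  have : CompleteSpace C := isClosed_closure.completeSpace_coe
  obtain ⟨c, hc⟩ := hne true
  have : Nonempty C := ⟨⟨c, hDC _ hc⟩⟩
  let i : C → Z := Subtype.val
  have hfi : f ∘ i ∈ H₁ C Y := H₁.comp_continuous hf continuous_subtype_val
  let G : Bool → Set C := fun b => f ∘ i ⁻¹' (Metric.cthickening (ε / 8) (f '' D b))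
  have hGδ : ∀ b, IsGδ (G b) := fun b => H₁.isGδ_preimage hfi Metric.isClosed_cthickening
  have hGd : ∀ b, Dense (G b) := by
    intro b
    have hd : Dense (i ⁻¹' D b) := by
      rw [Subtype.dense_iff, Subtype.image_preimage_coe, inter_eq_right.2 (hDC b)]
      exact hCD b
    refine hd.mono fun x hx => ?_
    exact Metric.self_subset_cthickening _ ⟨i x, hx, rfl⟩
  obtain ⟨x, hxt, hxf⟩ := ((hGd true).inter_of_Gδ (hGδ _) (hGδ _) (hGd false)).nonempty
  -- Two distances below `ε / 4` contradict the separation `ε / 2`.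
  have hsub := fun b => Metric.cthickening_subset_thickening' (δ₁ := ε / 8) (δ₂ := ε / 4)
    (by linarith) (by linarith) (f '' D b)
  obtain ⟨_, ⟨a, ha, rfl⟩, hax⟩ := Metric.mem_thickening_iff.1 (hsub _ hxt)
  obtain ⟨_, ⟨b, hb, rfl⟩, hbx⟩ := Metric.mem_thickening_iff.1 (hsub _ hxf)
  have h1 := hsep a ha b hb
  have h2 := dist_triangle_left (f a) (f b) ((f ∘ i) x)
  linarith

end Oscillation

/-! ### Ordinal ranks from transfinite peeling -/

section Rank

/-- The transfinite iteration of an operation on sets, taking unions at every stage. -/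
noncomputable def iterUnion {X : Type*} (step : Set X → Set X) (α : Ordinal) : Set X :=
  ⋃ β : Iio α, step (iterUnion step β)
termination_by α
decreasing_by exact β.2

theorem mem_iterUnion {X : Type*} {step : Set X → Set X} {α : Ordinal} {x : X} :
    x ∈ iterUnion step α ↔ ∃ β < α, x ∈ step (iterUnion step β) := by
  rw [iterUnion]
  simp

/-- If `f` has small oscillation somewhere on every nonempty closed set, then the space splits
into pieces of small oscillation indexed by an upper semicontinuous ordinal-valued rank. -/
theorem exists_rank {X : Type u} {Y : Type*} [TopologicalSpace X] [MetricSpace Y] {f : X → Y}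
    {ε : ℝ} (h : ∀ F : Set X, IsClosed F → F.Nonempty → ∃ W : Set X, IsOpen W ∧
      (W ∩ F).Nonempty ∧ ∀ x ∈ W ∩ F, ∀ y ∈ W ∩ F, dist (f x) (f y) ≤ ε) :
    ∃ r : X → Ordinal.{u}, (∀ x, ∀ᶠ y in 𝓝 x, r y ≤ r x) ∧
      ∀ x y, r x = r y → dist (f x) (f y) ≤ ε := by
  have h' : ∀ F : Set X, IsClosed F → ∃ W : Set X, IsOpen W ∧ (F.Nonempty → (W ∩ F).Nonempty) ∧
      ∀ x ∈ W ∩ F, ∀ y ∈ W ∩ F, dist (f x) (f y) ≤ ε := by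
    intro F hF
    rcases F.eq_empty_or_nonempty with rfl | hne
    · exact ⟨∅, isOpen_empty, by simp, by simp⟩
    · obtain ⟨W, h1, h2, h3⟩ := h F hF hne
      exact ⟨W, h1, fun _ => h2, h3⟩
  choose! W hWo hWne hWd using h'
  let step : Set X → Set X := fun U => U ∪ W Uᶜ
  let F : Ordinal.{u} → Set X := iterUnion step
  have hstep : ∀ U, IsOpen U → IsOpen (step U) := fun U hU =>
    hU.union (hWo _ hU.isClosed_compl)
  have hFo : ∀ α, IsOpen (F α) := by
    intro α
    induction α using WellFoundedLT.induction with
    | ind α ih =>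
      change IsOpen (iterUnion step α)
      rw [iterUnion]
      exact isOpen_iUnion fun β => hstep _ (ih β β.2)
  have hsub : ∀ α β, α < β → step (F α) ⊆ F β := fun α β hαβ x hx =>
    mem_iterUnion.2 ⟨α, hαβ, hx⟩
  -- Otherwise the stages grow strictly and inject the ordinals into `Set X`.
  obtain ⟨γ, hγ⟩ : ∃ γ, F γ = univ := by
    by_contra! hne
    have hlt : ∀ α β, α < β → F α ≠ F β := by
      intro α β hαβ heq
      obtain ⟨x, hxW, hx⟩ := hWne _ (hFo α).isClosed_compl (nonempty_compl.2 (hne α))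
      exact hx (heq ▸ hsub α β hαβ (Or.inr hxW))
    refine not_injective_of_ordinal F fun α β heq => ?_
    rcases lt_trichotomy α β with hαβ | hαβ | hαβ
    · exact absurd heq (hlt _ _ hαβ)
    · exact hαβ
    · exact absurd heq.symm (hlt _ _ hαβ)
  have hex : ∀ x, {α | x ∈ step (F α)}.Nonempty := by
    intro x
    obtain ⟨β, -, hβ⟩ := mem_iterUnion.1 (show x ∈ F γ from hγ ▸ mem_univ x)
    exact ⟨β, hβ⟩
  let r : X → Ordinal.{u} := fun x => sInf {α | x ∈ step (F α)}
  have hr : ∀ x, x ∈ step (F (r x)) := fun x => csInf_mem (hex x)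
  have hrle : ∀ x α, x ∈ step (F α) → r x ≤ α := fun x α hx => csInf_le' hx
  have hrW : ∀ x, x ∈ W (F (r x))ᶜ ∩ (F (r x))ᶜ := by
    intro x
    have hx : x ∉ F (r x) := by
      intro hx
      obtain ⟨β, hβ, hxβ⟩ := mem_iterUnion.1 hx
      exact absurd (hrle x β hxβ) (not_le.2 hβ)
    exact ⟨(hr x).resolve_left hx, hx⟩
  refine ⟨r, fun x => ?_, fun x y hxy => ?_⟩
  · filter_upwards [(hstep _ (hFo (r x))).mem_nhds (hr x)] with y hy using hrle _ _ hy
  · have hy := hrW y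
    rw [← hxy] at hy
    exact hWd _ (hFo _).isClosed_compl x (hrW x) y hy

theorem H₁.exists_rank {X : Type u} {Y : Type*} [MetricSpace X] [CompleteSpace X]
    [MetricSpace Y] {f : X → Y} (hf : f ∈ H₁ X Y) {ε : ℝ} (hε : 0 < ε) :
    ∃ r : X → Ordinal.{u}, (∀ x, ∀ᶠ y in 𝓝 x, r y ≤ r x) ∧
      ∀ x y, r x = r y → dist (f x) (f y) ≤ ε := by
  refine BaireOne.exists_rank fun F hF hne => ?_
  have : CompleteSpace F := hF.completeSpace_coe
  have : Nonempty F := hne.to_subtype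
  obtain ⟨U, hU, ⟨x, hx⟩, hd⟩ :=
    H₁.exists_isOpen_dist_le (H₁.comp_continuous hf (continuous_subtype_val (p := (· ∈ F)))) hε
  obtain ⟨W, hW, rfl⟩ := isOpen_induced_iff.1 hU
  exact ⟨W, hW, ⟨x, hx, x.2⟩, fun a ha b hb => hd ⟨a, ha.2⟩ ha.1 ⟨b, hb.2⟩ hb.1⟩

end Rank

/-! ### Clopen partitions of small mesh -/

section Partition

theorem StronglyZeroDimensional.exists_isClopen {X : Type*} [TopologicalSpace X] [NormalSpace X]
    (hX : StronglyZeroDimensional X) {F U : Set X} (hF : IsClosed F) (hU : IsOpen U)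
    (hFU : F ⊆ U) : ∃ W : Set X, IsClopen W ∧ F ⊆ W ∧ W ⊆ U := by
  obtain ⟨g, h0, h1, hg⟩ := exists_continuous_zero_one_of_isClosed hF hU.isClosed_compl
    (disjoint_compl_right_iff_subset.2 hFU)
  obtain ⟨W, hW, hFW, hWU⟩ := hX F Uᶜ ⟨g, g.continuous, hg, h0, h1⟩
  exact ⟨W, hW, hFW, by rwa [compl_compl] at hWU⟩

/-- A strongly zero-dimensional metric space has clopen partitions of arbitrarily small mesh. -/
theorem StronglyZeroDimensional.exists_isLocallyConstant {X : Type*} [MetricSpace X]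
    (hX : StronglyZeroDimensional X) {ε : ℝ} (hε : 0 < ε) :
    ∃ P : X → X, IsLocallyConstant P ∧ ∀ x y, P x = P y → dist x y < ε := by
  obtain ⟨u, huo, huU, hulf, hub⟩ := precise_refinement (fun x : X => Metric.ball x (ε / 2))
    (fun _ => Metric.isOpen_ball)
    (eq_univ_of_forall fun x => mem_iUnion.2 ⟨x, Metric.mem_ball_self (half_pos hε)⟩)
  obtain ⟨v, hvU, hvc, hvu⟩ := exists_iUnion_eq_closed_subset huo hulf.point_finite huU
  choose w hwc hvw hwu using fun i => hX.exists_isClopen (hvc i) (huo i) (hvu i)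
  have hwlf : LocallyFinite w := hulf.subset hwu
  have hex : ∀ x, {i | x ∈ w i}.Nonempty := by
    intro x
    obtain ⟨i, hi⟩ := mem_iUnion.1 (show x ∈ ⋃ i, v i from hvU ▸ mem_univ x)
    exact ⟨i, hvw i hi⟩
  have wf : WellFounded (WellOrderingRel (α := X)) := WellOrderingRel.isWellOrder.wf
  -- The first clopen set containing `x`; by local finiteness, points near `x` lie in no member that
  -- misses `x`.
  let P : X → X := fun x => wf.min {i | x ∈ w i} (hex x)
  have hP : ∀ x, x ∈ w (P x) := fun x => wf.min_mem _ (hex x)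
  have hPn : ∀ x i, x ∈ w i → ¬ WellOrderingRel i (P x) := fun x i hi =>
    wf.not_lt_min {i | x ∈ w i} hi
  refine ⟨P, (IsLocallyConstant.iff_eventually_eq P).2 fun x => ?_, fun x y hxy => ?_⟩
  · have hcl : IsClosed (⋃ i : {i // x ∉ w i}, w i) :=
      (hwlf.comp_injective Subtype.val_injective).isClosed_iUnion fun i => (hwc i).1
    have hx : x ∉ ⋃ i : {i // x ∉ w i}, w i := by
      simp
    filter_upwards [hcl.isOpen_compl.mem_nhds hx, (hwc (P x)).2.mem_nhds (hP x)] with y hy hyP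
    have hyw : ∀ i, y ∈ w i → x ∈ w i := by
      intro i hyi
      by_contra hxi
      exact hy (mem_iUnion.2 ⟨⟨i, hxi⟩, hyi⟩)
    rcases trichotomous_of WellOrderingRel (P y) (P x) with h | h | h
    · exact absurd h (hPn x _ (hyw _ (hP y)))
    · exact h
    · exact absurd h (hPn y _ hyP)
  · have h1 : dist x (P x) < ε / 2 := hub _ (hwu _ (hP x))
    have h2 : dist y (P x) < ε / 2 := hub _ (hwu _ (hxy ▸ hP y))
    have := dist_triangle_right x y (P x)
    linarith

end Partition

/-! ### Construction of the approximating sequence -/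

section Limit

/-- A point having, up to level `k`, every property of a decreasing sequence that is attained. -/
theorem exists_forall_le_of_antitone {X : Type*} [Nonempty X] {G : ℕ → Set X} (hG : Antitone G)
    (k : ℕ) : ∃ z, ∀ n ≤ k, (G n).Nonempty → z ∈ G n := by
  induction k with
  | zero =>
    by_cases h : (G 0).Nonempty
    · obtain ⟨z, hz⟩ := h
      exact ⟨z, fun n hn _ => by rwa [Nat.le_zero.1 hn]⟩
    · exact ⟨Classical.arbitrary X, fun n hn hne => absurd (Nat.le_zero.1 hn ▸ hne) h⟩
  | succ k ih =>
    by_cases h : (G (k + 1)).Nonempty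
    · obtain ⟨z, hz⟩ := h
      exact ⟨z, fun n hn _ => hG hn hz⟩
    · obtain ⟨z, hz⟩ := ih
      refine ⟨z, fun n hn hne => ?_⟩
      rcases Nat.le_succ_iff.1 hn with hn | rfl
      · exact hz n hn hne
      · exact absurd hne h

theorem H₁_subset_B₁ {X Y : Type*} [MetricSpace X] [CompleteSpace X] [MetricSpace Y]
    (hX : StronglyZeroDimensional X) : H₁ X Y ⊆ B₁ X Y := by
  intro f hf
  rcases isEmpty_or_nonempty X with hE | hE
  · exact ⟨fun _ => f, fun _ => continuous_of_const fun x => isEmptyElim x,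
      fun x => isEmptyElim x⟩
  have hpos : ∀ n : ℕ, 0 < 1 / ((n : ℝ) + 1) := fun n => Nat.one_div_pos_of_nat
  choose r hr hrd using fun n : ℕ => H₁.exists_rank hf (hpos n)
  choose P hPc hPd using fun n : ℕ => hX.exists_isLocallyConstant (hpos n)
  -- Points of the cell `c` maximising `r 0, ..., r n` at once; there may be none.
  let G : ℕ → X → ℕ → Set X := fun k c n =>
    {z | P k z = c ∧ ∀ i ≤ n, ∀ v, P k v = c → r i v ≤ r i z}
  have hG : ∀ k c, Antitone (G k c) := fun k c m n hmn z hz =>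
    ⟨hz.1, fun i hi => hz.2 i (hi.trans hmn)⟩
  choose z hz using fun k c => exists_forall_le_of_antitone (hG k c) k
  refine ⟨fun k x => f (z k (P k x)), fun k => ((hPc k).comp fun c => f (z k c)).continuous,
    fun x => Metric.tendsto_atTop.2 fun ε hε => ?_⟩
  obtain ⟨n, hn⟩ := exists_nat_one_div_lt hε
  have hnear : ∀ᶠ y in 𝓝 x, ∀ i ∈ Iic n, r i y ≤ r i x :=
    (eventually_all_finite (finite_Iic n)).2 fun i _ => hr i x
  obtain ⟨η, hη, hball⟩ := Metric.eventually_nhds_iff.1 hnear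
  obtain ⟨K, hK⟩ := exists_nat_one_div_lt hη
  refine ⟨max n K, fun k hk => ?_⟩
  have hxG : x ∈ G k (P k x) n := by
    refine ⟨rfl, fun i hi v hv => hball ?_ i hi⟩
    exact (hPd k v x hv).trans
      (lt_of_le_of_lt (Nat.one_div_le_one_div (le_of_max_le_right hk)) hK)
  have hzG := hz k (P k x) n (le_of_max_le_left hk) ⟨x, hxG⟩
  exact (hrd n _ _ (le_antisymm (hxG.2 n le_rfl _ hzG.1) (hzG.2 n le_rfl _ hxG.1))).trans_lt hn

end Limit

/-! ### The elementary inclusions -/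

section Inclusions

theorem IsZeroSet.isClosed {X : Type*} [TopologicalSpace X] {A : Set X} (hA : IsZeroSet A) :
    IsClosed A := by
  obtain ⟨g, hg, rfl⟩ := hA
  exact isClosed_eq hg continuous_const

theorem isZeroSet_of_isClosed {X : Type*} [MetricSpace X] {A : Set X} (hA : IsClosed A) :
    IsZeroSet A := by
  rcases A.eq_empty_or_nonempty with rfl | hne
  · exact ⟨fun _ => 1, continuous_const, by simp⟩
  · exact ⟨fun x => Metric.infDist x A, Metric.continuous_infDist_pt A,
      ext fun x => hA.mem_iff_infDist_zero hne⟩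

theorem K₁_subset_H₁ {X Y : Type*} [TopologicalSpace X] [TopologicalSpace Y] :
    K₁ X Y ⊆ H₁ X Y := by
  intro f hf V hV
  obtain ⟨Z, hZ, h⟩ := hf V hV
  exact ⟨Z, fun n => (hZ n).isClosed, h⟩

theorem B₁_subset_K₁ {X Y : Type*} [MetricSpace X] [MetricSpace Y] : B₁ X Y ⊆ K₁ X Y := by
  rintro f ⟨u, hu, hlim⟩ V hV
  -- Closed sets exhausting `V`: `f x ∈ V` exactly when the `u n x` eventually stay in one of them.
  -- The extended distance also covers `V = univ`.
  let A : ℕ → Set Y := fun m => {y | (m : ENNReal)⁻¹ ≤ Metric.infEDist y Vᶜ}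
  have hA : ∀ m, IsClosed (A m) := fun m =>
    isClosed_le continuous_const Metric.continuous_infEDist
  let Z : ℕ → Set X := fun p => ⋂ n : ℕ, u (p.unpair.2 + n) ⁻¹' A p.unpair.1
  have hZ : ∀ p, IsClosed (Z p) := fun p => isClosed_iInter fun n => (hA _).preimage (hu _)
  refine ⟨Z, fun p => isZeroSet_of_isClosed (hZ p), Subset.antisymm (fun x hx => ?_) ?_⟩
  · have hpos : Metric.infEDist (f x) Vᶜ ≠ 0 := fun h0 =>
      ((Metric.mem_iff_infEDist_zero_of_closed hV.isClosed_compl).2 h0) hx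
    obtain ⟨m, hm⟩ := ENNReal.exists_inv_nat_lt hpos
    have hev : ∀ᶠ n in atTop, u n x ∈ A m :=
      (((Metric.continuous_infEDist.tendsto (f x)).comp (hlim x)).eventually_const_lt hm).mono
        fun n hn => hn.le
    obtain ⟨N, hN⟩ := eventually_atTop.1 hev
    refine mem_iUnion.2 ⟨Nat.pair m N, mem_iInter.2 fun n => ?_⟩
    rw [Nat.unpair_pair]
    exact hN _ (Nat.le_add_right _ _)
  · refine iUnion_subset fun p x hx => ?_
    have hfx : f x ∈ A p.unpair.1 := by
      refine (hA _).mem_of_tendsto (hlim x) (eventually_atTop.2 ⟨p.unpair.2, fun n hn => ?_⟩)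
      have := mem_iInter.1 hx (n - p.unpair.2)
      rwa [Nat.add_sub_cancel' hn] at this
    by_contra hxV
    have h0 : Metric.infEDist (f x) Vᶜ = 0 := Metric.infEDist_zero_of_mem hxV
    have hfx' : ((p.unpair.1 : ℕ) : ENNReal)⁻¹ ≤ Metric.infEDist (f x) Vᶜ := hfx
    rw [h0] at hfx'
    exact ENNReal.natCast_ne_top _ (ENNReal.inv_eq_zero.1 (le_antisymm hfx' zero_le))

end Inclusions

end BaireOne

theorem mainTheorem2 {X Y : Type*} [TopologicalSpace X] [TopologicalSpace Y]
    [TopologicalSpace.IsCompletelyMetrizableSpace X]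
    (hX : BaireOne.StronglyZeroDimensional X) [TopologicalSpace.MetrizableSpace Y] :
    BaireOne.K₁ X Y = BaireOne.B₁ X Y ∧ BaireOne.H₁ X Y ⊆ BaireOne.B₁ X Y := by
  let := TopologicalSpace.upgradeIsCompletelyMetrizable X
  let := TopologicalSpace.metrizableSpaceMetric Y
  have h := BaireOne.H₁_subset_B₁ (Y := Y) hX
  exact ⟨Set.Subset.antisymm (BaireOne.K₁_subset_H₁.trans h) BaireOne.B₁_subset_K₁, h⟩
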